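/- **Theorem (Scale invariant t-test martingale).** Let $X_1,X_2,\dots$ be real random variables on a measurable space, and write $S_n=\sum_{i=1}^n X_i$, $V_n=\sum_{i=1}^n X_i^2$, $\overline{X}_n=S_n/n$, $\overline{X^2_n}=V_n/n$. Let $\mathcal N$ be the class of all normal distributions $N_{\mu,\sigma^2}$ on $\mathbb R$ with $\mu\in\mathbb R$, $\sigma^2>0$, let $\mathcal N_{\mu=0}$ be the subclass of those with mean $0$, and let $p_{\mu,\sigma^2}$ be the density of $N_{\mu,\sigma^2}$. For $n\ge1$ let $\mathcal F_n^*$ be the $\sigma$-algebra generated by all $f(X_1,\dots,X_n)$ with $f:\mathbb R^n\to\mathbb R$ measurable and scale invariant, i.e. $f(\lambda x_1,\dots,\lambda x_n)=f(x_1,\dots,x_n)$ for all $\lambda>0$. Let $c>0$ and $$G_n^{(c)}=\sqrt{\frac{c^2}{n+c^2}}\left(\frac{(n+c^2)V_n}{(n+c^2)V_n-S_n^2}\right)^{n/2},\qquad n\ge 1$$ (with the convention $G_n^{(c)}=0$ on the event $V_n=0$, which is null when the data are i.i.d. normal). 1. $\{G_n^{(c)}\}_{n\ge1}$ is a test martingale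 for $\mathcal N_{\mu=0}$ on $\{\mathcal F_n^*\}_{n\ge1}$: whenever $X_1,X_2,\dots$ are i.i.d. with a distribution in $\mathcal N_{\mu=0}$, it is a nonnegative martingale with respect to $\{\mathcal F^*_n\}$, with $G_1^{(c)}=1$ almost surely and $\mathbb E[G_n^{(c)}]=1$ for all $n\ge1$. 2. It is a Gaussian mixture of scale invariant likelihood ratios: for every $n\ge 1$, wherever $V_n>0$, $$G_n^{(c)}=\int_{\mathbb R}h_n(\theta;0)\,N_{0,c^{-2}}(\mathrm d\theta),\qquad h_n(\theta;\theta_0)=\frac{\int_0^\infty\left\{\prod_{i=1}^n p_{\tau\theta,\tau^2}(X_i)\right\}\frac{\mathrm d\tau}{\tau}}{\int_0^\infty\left\{\prod_{i=1}^n p_{\tau\theta_0,\tau^2}(X_i)\right\}\frac{\mathrm d\tau}{\tau}}.$$ 3. For every $\alpha\in(0,1)$, with $$\operatorname{radius}_n=\sqrt{\frac{(n+c^2)\left(1-\left(\frac{\alpha^2c^2}{n+c^2}\right)^{1/n}\right)}{\left\{\left(\frac{\alpha^2c^2}{n+c^2}\right)^{1/n}(n+c^2)-c^2\right\}\vee0}\left(\overline{X^2_n}-\overline{X}_n^2\right)}$$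 (and $\operatorname{radius}_n=\infty$, so that the interval is all of $\mathbb R$, when the denominator is $0$), the intervals $[\overline X_n\pm\operatorname{radius}_n]$ form a $(1-\alpha)$-confidence sequence for the mean over $\mathcal N$: whenever $X_1,X_2,\dots$ are i.i.d. with distribution $N_{\mu,\sigma^2}\in\mathcal N$, $$\Pr\left[\,\forall n\ge1,\ \mu\in[\overline X_n\pm\operatorname{radius}_n]\,\right]\ge1-\alpha .$$ -/

import Mathlib

open MeasureTheory ProbabilityTheory
open scoped ENNReal NNReal

noncomputable section

namespace TTest

/-- The class of all nondegenerate normal distributions on `ℝ`. -/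
def normalClass : Set (Measure ℝ) :=
  {P | ∃ (m : ℝ) (v : ℝ≥0), v ≠ 0 ∧ P = gaussianReal m v}

/-- The class of all nondegenerate normal distributions on `ℝ` with mean `m`. -/
def normalClassMean (m : ℝ) : Set (Measure ℝ) :=
  {P | ∃ v : ℝ≥0, v ≠ 0 ∧ P = gaussianReal m v}

/-- The mean of a distribution on `ℝ`. -/
def mean (P : Measure ℝ) : ℝ := ∫ y, y ∂P

/-- The partial sum `S_n`. A sequence `x₁, x₂, …` is indexed from `0`, so `xᵢ₊₁` is `x i`. -/
def partialSum (n : ℕ) (x : ℕ → ℝ) : ℝ := ∑ i ∈ Finset.range n, x i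

/-- The partial sum of squares `V_n`. -/
def partialSumSq (n : ℕ) (x : ℕ → ℝ) : ℝ := ∑ i ∈ Finset.range n, x i ^ 2

/-- The sample average `S_n / n`. -/
def sampleMean (n : ℕ) (x : ℕ → ℝ) : ℝ := partialSum n x / n

/-- The average square `V_n / n`. -/
def sampleMeanSq (n : ℕ) (x : ℕ → ℝ) : ℝ := partialSumSq n x / n

/-- The process `G_n^{(c)}` as a function of the data. -/
def gValue (c : ℝ) (n : ℕ) (x : ℕ → ℝ) : ℝ :=
  √(c ^ 2 / (n + c ^ 2)) *
    (((n + c ^ 2) * partialSumSq n x) /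
      ((n + c ^ 2) * partialSumSq n x - partialSum n x ^ 2)) ^ ((n : ℝ) / 2)

/-- The mixture `∫_{τ > 0} ∏_{i ≤ n} p_{τθ, τ²}(x_i) dτ / τ` of normal likelihoods. -/
def scaleMixtureLikelihood (n : ℕ) (θ : ℝ) (x : ℕ → ℝ) : ℝ≥0∞ :=
  ∫⁻ τ in Set.Ioi (0 : ℝ),
    (∏ i ∈ Finset.range n, gaussianPDF (τ * θ) (τ ^ 2).toNNReal (x i)) * ENNReal.ofReal τ⁻¹

/-- The scale invariant likelihood ratio `h_n(θ; θ₀)` of the normal family. -/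
def scaleInvLR (n : ℕ) (θ θ₀ : ℝ) (x : ℕ → ℝ) : ℝ≥0∞ :=
  scaleMixtureLikelihood n θ x / scaleMixtureLikelihood n θ₀ x

/-- The denominator `(α² c² / (n + c²))^{1/n} (n + c²) - c²` of the squared radius, before its
positive part is taken. -/
def radiusDenom (c α : ℝ) (n : ℕ) : ℝ :=
  (α ^ 2 * c ^ 2 / (n + c ^ 2)) ^ (1 / (n : ℝ)) * (n + c ^ 2) - c ^ 2

/-- The radius of the interval at time `n`; it is infinite as soon as the positive part of the
denominator is zero, whatever the sample variance is. -/
def radius (c α : ℝ) (n : ℕ) (x : ℕ → ℝ) : EReal :=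
  if max (radiusDenom c α n) 0 = 0 then ⊤
  else ((√((n + c ^ 2) * (1 - (α ^ 2 * c ^ 2 / (n + c ^ 2)) ^ (1 / (n : ℝ))) /
      max (radiusDenom c α n) 0 * (sampleMeanSq n x - sampleMean n x ^ 2)) : ℝ) : EReal)

/-- The interval of the real numbers between `sampleMean - radius` and `sampleMean + radius`. -/
def interval (c α : ℝ) (n : ℕ) (x : ℕ → ℝ) : Set ℝ :=
  {m : ℝ | (sampleMean n x : EReal) - radius c α n x ≤ (m : EReal) ∧
    (m : EReal) ≤ (sampleMean n x : EReal) + radius c α n x}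

/-- Scale invariant (measurable) functions on `ℝⁿ`. -/
def IsScaleInvariant {n : ℕ} (f : (Fin n → ℝ) → ℝ) : Prop :=
  Measurable f ∧ ∀ (x : Fin n → ℝ) (l : ℝ), 0 < l → f (fun i => l * x i) = f x

variable {Ω : Type*}

/-- The `σ`-algebra generated by all `f(X₁, …, X_n)` with `f` scale invariant. -/
@[reducible] def scaleInvSigma (X : ℕ → Ω → ℝ) (n : ℕ) : MeasurableSpace Ω :=
  ⨆ (f : (Fin n → ℝ) → ℝ) (_ : IsScaleInvariant f),
    MeasurableSpace.comap (fun ω => f (fun i : Fin n => X i ω)) inferInstance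

theorem scaleInvSigma_le [mΩ : MeasurableSpace Ω] (X : ℕ → Ω → ℝ) (hX : ∀ i, Measurable (X i))
    (n : ℕ) : scaleInvSigma X n ≤ mΩ := by
  refine iSup₂_le fun f hf => ?_
  have h : Measurable (fun ω => f (fun i : Fin n => X i ω)) :=
    hf.1.comp (measurable_pi_lambda _ fun i => hX i)
  exact h.comap_le

theorem scaleInvSigma_mono (X : ℕ → Ω → ℝ) {m n : ℕ} (h : m ≤ n) :
    scaleInvSigma X m ≤ scaleInvSigma X n := by
  refine iSup₂_le fun f hf => ?_
  have hg : IsScaleInvariant (fun x : Fin n → ℝ => f (fun i => x (Fin.castLE h i))) :=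
    ⟨hf.1.comp (measurable_pi_lambda _ fun i => measurable_pi_apply _),
      fun x l hl => hf.2 (fun i => x (Fin.castLE h i)) l hl⟩
  exact le_iSup₂_of_le (f := fun (f : (Fin n → ℝ) → ℝ) (_ : IsScaleInvariant f) =>
    MeasurableSpace.comap (fun ω => f (fun i : Fin n => X i ω)) inferInstance) _ hg le_rfl

variable [mΩ : MeasurableSpace Ω]

/-- The scale invariant filtration of the data, at the times `n ≥ 1`. -/
def scaleInvFiltration (X : ℕ → Ω → ℝ) (hX : ∀ i, Measurable (X i)) : Filtration ℕ+ mΩ where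
  seq n := scaleInvSigma X n
  mono' _ _ h := scaleInvSigma_mono X h
  le' n := scaleInvSigma_le X hX n

/-- Under `Pr`, the observations `X` are i.i.d. with distribution `P`. -/
def IsIIDSample (X : ℕ → Ω → ℝ) (P : Measure ℝ) (Pr : Measure Ω) : Prop :=
  (∀ i, Measurable (X i)) ∧ iIndepFun X Pr ∧ ∀ i, Pr.map (X i) = P

/-- `M` is a test martingale for the class `𝓠` on the filtration `ℱ`: whenever the data are i.i.d.
from a member of `𝓠`, it is a nonnegative martingale whose initial value has mean one. -/
def IsTestMartingale (X : ℕ → Ω → ℝ) (𝓠 : Set (Measure ℝ)) (ℱ : Filtration ℕ+ mΩ)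
    (M : ℕ+ → Ω → ℝ) : Prop :=
  ∀ P ∈ 𝓠, ∀ Pr : Measure Ω, IsProbabilityMeasure Pr → IsIIDSample X P Pr →
    (∀ n ω, 0 ≤ M n ω) ∧ Martingale M ℱ Pr ∧ ∫ ω, M 1 ω ∂Pr = 1

/-- `CI` is a `(1 - α)`-confidence sequence for the parameter `θ` over the class `𝓠`. -/
def IsConfidenceSequence (X : ℕ → Ω → ℝ) (𝓠 : Set (Measure ℝ)) (θ : Measure ℝ → ℝ) (α : ℝ)
    (CI : ℕ+ → Ω → Set ℝ) : Prop :=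
  ∀ P ∈ 𝓠, ∀ Pr : Measure Ω, IsProbabilityMeasure Pr → IsIIDSample X P Pr →
    ENNReal.ofReal (1 - α) ≤ Pr {ω | ∀ n : ℕ+, θ P ∈ CI n ω}

end TTest

end

/-! The process is a likelihood ratio on scale invariant events. Write `V` and `S` for the sum of
squares and the sum, and `D = V - S ^ 2 / (n + c ^ 2)`. Integrating a density over all rescalings of
the data against `dτ / τ` keeps only its scale invariant content. The centred normal density becomes
`J * V ^ (-n / 2)`. Mixing the mean over the prior completes a square, so the mixture of
alternatives becomes `√(c ^ 2 / (n + c ^ 2)) * J * D ^ (-n / 2)`, with the same constant `J =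
scaleIntegral n 1`. Their quotient is the process, which is `gValue_eq_lintegral_scaleInvLR`.

`lintegral_gValue_mul` turns this quotient into a change of measure: under any centred normal law,
integrating the process over a scale invariant event gives the probability of that event under the
mixture of alternatives. The mixture is one measure on infinite sequences, so this mass does not
depend on the time. Hence the martingale property, and mean one by taking the whole space.

For the confidence sequence, subtracting the true mean puts the data under the null. By
`ville_inequality` the process then stays below `α⁻¹` forever with probability at least `1 - α`, and
`mem_interval_of_gValue_lt` solves this bound for the mean. -/

noncomputable section

namespace TTest

/-! ### Normal likelihoods and the normal prior. -/

/-- The value at scale `τ` of the density of `n` independent normal variables, as a function of the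
sum `A` of the squared deviations from the mean. -/
def gaussKernel (n : ℕ) (τ A : ℝ) : ℝ :=
  ((√(2 * Real.pi) * τ) ^ n)⁻¹ * Real.exp (-A / (2 * τ ^ 2))

lemma gaussKernel_nonneg (n : ℕ) {τ : ℝ} (hτ : 0 ≤ τ) (A : ℝ) : 0 ≤ gaussKernel n τ A := by
  unfold gaussKernel; positivity

lemma gaussKernel_pos (n : ℕ) {τ : ℝ} (hτ : 0 < τ) (A : ℝ) : 0 < gaussKernel n τ A := by
  have := Real.pi_pos
  unfold gaussKernel; positivity

lemma gaussKernel_scale (n : ℕ) {τ a : ℝ} (hτ : 0 < τ) (ha : 0 < a) (A : ℝ) :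
    gaussKernel n (a * τ) A = (a ^ n)⁻¹ * gaussKernel n τ (A / a ^ 2) := by
  unfold gaussKernel
  have h1 : √(2 * Real.pi) * (a * τ) = a * (√(2 * Real.pi) * τ) := by ring
  have h2 : -A / (2 * (a * τ) ^ 2) = -(A / a ^ 2) / (2 * τ ^ 2) := by field_simp
  rw [h1, h2, mul_pow, mul_inv, mul_assoc]

lemma measurable_gaussKernel (n : ℕ) :
    Measurable fun p : ℝ × ℝ => gaussKernel n p.1 p.2 := by
  unfold gaussKernel; fun_prop

lemma prod_gaussianPDF {ι : Type*} (s : Finset ι) (m : ℝ) {τ : ℝ} (hτ : 0 < τ) (x : ι → ℝ) :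
    ∏ i ∈ s, gaussianPDF m (τ ^ 2).toNNReal (x i) =
      ENNReal.ofReal (gaussKernel s.card τ (∑ i ∈ s, (x i - m) ^ 2)) := by
  simp only [gaussianPDF]
  rw [← ENNReal.ofReal_prod_of_nonneg fun i _ => gaussianPDFReal_nonneg _ _ _]
  congr 1
  simp only [gaussianPDFReal, Real.coe_toNNReal _ (sq_nonneg τ), gaussKernel]
  rw [Finset.prod_mul_distrib, Finset.prod_const, ← Real.exp_sum, ← Finset.sum_div,
    Finset.sum_neg_distrib, Real.sqrt_mul (by positivity), Real.sqrt_sq hτ.le, inv_pow]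

lemma sum_sub_sq {ι : Type*} (s : Finset ι) (x : ι → ℝ) (m : ℝ) :
    ∑ i ∈ s, (x i - m) ^ 2 = ∑ i ∈ s, x i ^ 2 - 2 * m * ∑ i ∈ s, x i + s.card * m ^ 2 := by
  simp only [sub_sq, Finset.sum_add_distrib, Finset.sum_sub_distrib, Finset.sum_const,
    nsmul_eq_mul, Finset.mul_sum]
  congr 2
  exact Finset.sum_congr rfl fun i _ => by ring

lemma lintegral_gaussKernel_prior (n : ℕ) {c : ℝ} (hc : 0 < c) {τ : ℝ} (hτ : 0 < τ) (V S : ℝ) :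
    ∫⁻ θ, ENNReal.ofReal (gaussKernel n τ (V - 2 * (τ * θ) * S + n * (τ * θ) ^ 2))
        ∂(gaussianReal 0 (1 / c ^ 2).toNNReal) =
      ENNReal.ofReal (√(c ^ 2 / (n + c ^ 2)) * gaussKernel n τ (V - S ^ 2 / (n + c ^ 2))) := by
  have hv : (1 / c ^ 2).toNNReal ≠ 0 := by
    simp only [ne_eq, Real.toNNReal_eq_zero, not_le]; positivity
  have hv' : (1 / (n + c ^ 2)).toNNReal ≠ 0 := by
    simp only [ne_eq, Real.toNNReal_eq_zero, not_le]; positivity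
  rw [gaussianReal_of_var_ne_zero _ hv, lintegral_withDensity_eq_lintegral_mul _
    (measurable_gaussianPDF _ _) (by
      exact ((measurable_gaussKernel n).comp (by fun_prop :
        Measurable fun θ : ℝ => (τ, V - 2 * (τ * θ) * S + n * (τ * θ) ^ 2))).ennreal_ofReal)]
  -- Bayes' rule for conjugate normals: prior times likelihood is the marginal times the posterior
  -- density, with posterior mean `S / τ / (n + c ^ 2)` and variance `1 / (n + c ^ 2)`.
  have key : ∀ θ : ℝ, (gaussianPDF 0 (1 / c ^ 2).toNNReal *
      fun θ => ENNReal.ofReal (gaussKernel n τ (V - 2 * (τ * θ) * S + n * (τ * θ) ^ 2))) θ =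
      ENNReal.ofReal (√(c ^ 2 / (n + c ^ 2)) * gaussKernel n τ (V - S ^ 2 / (n + c ^ 2))) *
        gaussianPDF (S / τ / (n + c ^ 2)) (1 / (n + c ^ 2)).toNNReal θ := by
    intro θ
    simp only [Pi.mul_apply, gaussianPDF]
    rw [← ENNReal.ofReal_mul (gaussianPDFReal_nonneg _ _ _), ← ENNReal.ofReal_mul
      (mul_nonneg (Real.sqrt_nonneg _) (gaussKernel_nonneg n hτ.le _))]
    congr 1
    simp only [gaussianPDFReal, gaussKernel]
    rw [Real.coe_toNNReal _ (by positivity), Real.coe_toNNReal _ (by positivity)]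
    have h1 : (√(2 * Real.pi * (1 / c ^ 2)))⁻¹ =
        √(c ^ 2 / (n + c ^ 2)) * (√(2 * Real.pi * (1 / (n + c ^ 2))))⁻¹ := by
      rw [← Real.sqrt_inv, ← Real.sqrt_inv, ← Real.sqrt_mul (by positivity)]
      congr 1
      have := Real.pi_pos
      field_simp
    rw [h1]
    have h2 : Real.exp (-(θ - 0) ^ 2 / (2 * (1 / c ^ 2))) *
        Real.exp (-(V - 2 * (τ * θ) * S + n * (τ * θ) ^ 2) / (2 * τ ^ 2)) =
        Real.exp (-(V - S ^ 2 / (n + c ^ 2)) / (2 * τ ^ 2)) *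
        Real.exp (-(θ - S / τ / (n + c ^ 2)) ^ 2 / (2 * (1 / (n + c ^ 2)))) := by
      rw [← Real.exp_add, ← Real.exp_add]
      congr 1
      have : (n : ℝ) + c ^ 2 ≠ 0 := by positivity
      field_simp
      ring
    linear_combination (√(c ^ 2 / (n + c ^ 2)) * (√(2 * Real.pi * (1 / (n + c ^ 2))))⁻¹ *
      ((√(2 * Real.pi) * τ) ^ n)⁻¹) * h2
  rw [lintegral_congr key, lintegral_const_mul _ (measurable_gaussianPDF _ _),
    lintegral_gaussianPDF_eq_one _ hv', mul_one]

/-! ### The Haar measure `dτ / τ` on scales: its symmetries and the integral of the kernel. -/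

lemma lintegral_Ioi_comp_mul (F : ℝ → ℝ≥0∞) {a : ℝ} (ha : 0 < a) :
    ∫⁻ τ in Set.Ioi (0 : ℝ), F (a * τ) * ENNReal.ofReal τ⁻¹ =
      ∫⁻ τ in Set.Ioi (0 : ℝ), F τ * ENNReal.ofReal τ⁻¹ := by
  have himg : (fun τ : ℝ => a * τ) '' Set.Ioi 0 = Set.Ioi 0 := by
    simpa using Set.image_mul_left_Ioi ha (b := (0 : ℝ))
  have h := lintegral_image_eq_lintegral_abs_deriv_mul (f := fun τ : ℝ => a * τ) (f' := fun _ => a)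
    (measurableSet_Ioi (a := (0 : ℝ)))
    (fun x _ => by simpa using ((hasDerivAt_id x).const_mul a).hasDerivWithinAt)
    ((mul_right_injective₀ ha.ne').injOn) (fun τ => F τ * ENNReal.ofReal τ⁻¹)
  rw [himg] at h
  rw [h]
  refine setLIntegral_congr_fun measurableSet_Ioi fun τ hτ => ?_
  have hτ' : (0 : ℝ) < τ := hτ
  rw [mul_left_comm, ← ENNReal.ofReal_mul (abs_nonneg a), abs_of_pos ha]
  congr 2
  field_simp

lemma lintegral_Ioi_comp_inv (F : ℝ → ℝ≥0∞) :
    ∫⁻ τ in Set.Ioi (0 : ℝ), F τ⁻¹ * ENNReal.ofReal τ⁻¹ =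
      ∫⁻ τ in Set.Ioi (0 : ℝ), F τ * ENNReal.ofReal τ⁻¹ := by
  have himg : (fun τ : ℝ => τ⁻¹) '' Set.Ioi 0 = Set.Ioi 0 := by
    ext y
    simp only [Set.mem_image, Set.mem_Ioi]
    exact ⟨fun ⟨x, hx, h⟩ => h ▸ inv_pos.2 hx, fun hy => ⟨y⁻¹, inv_pos.2 hy, inv_inv y⟩⟩
  have h := lintegral_image_eq_lintegral_abs_deriv_mul (f := fun τ : ℝ => τ⁻¹)
    (f' := fun τ => -(τ ^ 2)⁻¹) (measurableSet_Ioi (a := (0 : ℝ)))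
    (fun x hx => (hasDerivAt_inv (ne_of_gt hx)).hasDerivWithinAt)
    (inv_injective.injOn) (fun τ => F τ * ENNReal.ofReal τ⁻¹)
  rw [himg] at h
  rw [h]
  refine setLIntegral_congr_fun measurableSet_Ioi fun τ hτ => ?_
  have hτ' : (0 : ℝ) < τ := hτ
  rw [mul_left_comm, ← ENNReal.ofReal_mul (abs_nonneg _), abs_neg, abs_of_pos (by positivity)]
  congr 2
  field_simp

/-- The integral of `gaussKernel` over all scales with respect to `dτ / τ`. -/
def scaleIntegral (n : ℕ) (A : ℝ) : ℝ≥0∞ :=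
  ∫⁻ τ in Set.Ioi (0 : ℝ), ENNReal.ofReal (gaussKernel n τ A) * ENNReal.ofReal τ⁻¹

/-- Substituting `√A * τ` for `τ` moves all dependence on `A` into a power, because `dτ / τ` is
scale invariant. -/
lemma scaleIntegral_eq (n : ℕ) {A : ℝ} (hA : 0 < A) :
    scaleIntegral n A = ENNReal.ofReal (A ^ (-((n : ℝ) / 2))) * scaleIntegral n 1 := by
  unfold scaleIntegral
  rw [← lintegral_Ioi_comp_mul _ (Real.sqrt_pos.2 hA), ← lintegral_const_mul' _ _ (by simp)]
  refine setLIntegral_congr_fun measurableSet_Ioi fun τ hτ => ?_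
  rw [gaussKernel_scale n hτ (Real.sqrt_pos.2 hA), Real.sq_sqrt hA.le, div_self hA.ne',
    ENNReal.ofReal_mul (by positivity), mul_assoc]
  congr 2
  rw [Real.rpow_neg hA.le, Real.sqrt_eq_rpow, ← Real.rpow_natCast, ← Real.rpow_mul hA.le]
  congr 2
  ring

lemma scaleIntegral_one_ne_zero (n : ℕ) : scaleIntegral n 1 ≠ 0 := by
  unfold scaleIntegral
  rw [Ne, lintegral_eq_zero_iff (by
    exact (((measurable_gaussKernel n).comp (by fun_prop : Measurable fun τ : ℝ =>
      (τ, (1 : ℝ)))).ennreal_ofReal).mul (by fun_prop)),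
    Filter.EventuallyEq, ae_restrict_iff' measurableSet_Ioi]
  intro h
  have h0 : (volume : Measure ℝ) (Set.Ioi 0) = 0 := by
    refine measure_mono_null (fun τ hτ => ?_) h
    have hτ' : (0 : ℝ) < τ := hτ
    have := gaussKernel_pos n hτ' 1
    simp [hτ', this]
  simp at h0

lemma scaleIntegral_one_ne_top {n : ℕ} (hn : 1 ≤ n) : scaleIntegral n 1 ≠ ∞ := by
  unfold scaleIntegral
  -- Inversion turns the integrand into a multiple of `τ ^ (n - 1) * exp (-τ ^ 2 / 2)`, which is
  -- integrable near zero because `1 ≤ n`.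
  rw [← lintegral_Ioi_comp_inv]
  have hint := integrable_rpow_mul_exp_neg_mul_sq (b := 1 / 2) (by norm_num)
    (s := (n : ℝ) - 1) (by have : (1 : ℝ) ≤ n := by exact_mod_cast hn
                           linarith)
  have hfin := ((hint.const_mul ((√(2 * Real.pi)) ^ n)⁻¹).integrableOn
    (s := Set.Ioi 0)).lintegral_lt_top
  refine ne_top_of_le_ne_top hfin.ne (le_of_eq ?_)
  refine setLIntegral_congr_fun measurableSet_Ioi fun τ hτ => ?_
  have hτ' : (0 : ℝ) < τ := hτ
  rw [← ENNReal.ofReal_mul (gaussKernel_nonneg _ (by positivity) _)]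
  congr 1
  unfold gaussKernel
  rw [Real.rpow_sub_one hτ'.ne', Real.rpow_natCast]
  have : -1 / (2 * τ⁻¹ ^ 2) = -(1 / 2) * τ ^ 2 := by field_simp
  rw [this, mul_pow, inv_pow]
  field_simp

/-! ### The process as a mixture of scale invariant likelihood ratios. -/

lemma partialSum_sq_le (n : ℕ) (x : ℕ → ℝ) :
    partialSum n x ^ 2 ≤ n * partialSumSq n x := by
  simpa [partialSum, partialSumSq] using
    sq_sum_le_card_mul_sum_sq (s := Finset.range n) (f := x)

lemma partialSumSq_nonneg (n : ℕ) (x : ℕ → ℝ) : 0 ≤ partialSumSq n x :=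
  Finset.sum_nonneg fun i _ => sq_nonneg (x i)

lemma gValue_eq {c : ℝ} (hc : 0 < c) (n : ℕ) {x : ℕ → ℝ} (hV : 0 < partialSumSq n x) :
    gValue c n x = √(c ^ 2 / (n + c ^ 2)) *
      (partialSumSq n x ^ ((n : ℝ) / 2) *
      (partialSumSq n x - partialSum n x ^ 2 / (n + c ^ 2)) ^ (-((n : ℝ) / 2))) ∧
      0 < partialSumSq n x - partialSum n x ^ 2 / (n + c ^ 2) := by
  have hn : 0 < (n : ℝ) + c ^ 2 := by positivity
  have hD : 0 < partialSumSq n x - partialSum n x ^ 2 / (n + c ^ 2) := by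
    rw [sub_pos, div_lt_iff₀ hn]
    have := partialSum_sq_le n x
    nlinarith [mul_pos hV (pow_pos hc 2)]
  refine ⟨?_, hD⟩
  rw [gValue, Real.rpow_neg hD.le, ← div_eq_mul_inv, ← Real.div_rpow hV.le hD.le]
  congr 2
  have : (n + c ^ 2) * partialSumSq n x - partialSum n x ^ 2 =
      (n + c ^ 2) * (partialSumSq n x - partialSum n x ^ 2 / (n + c ^ 2)) := by
    field_simp
  rw [this, mul_div_mul_left _ _ hn.ne']

lemma gValue_nonneg {c : ℝ} (n : ℕ) (x : ℕ → ℝ) : 0 ≤ gValue c n x := by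
  refine mul_nonneg (Real.sqrt_nonneg _) (Real.rpow_nonneg ?_ _)
  have h1 := partialSum_sq_le n x
  have h2 := partialSumSq_nonneg n x
  have h3 := mul_nonneg (sq_nonneg c) h2
  refine div_nonneg (mul_nonneg (by positivity) h2) (by nlinarith)

/-- The value of `gValue` times the scale integral of the null density is the scale integral of the
mixture density. -/
lemma gValue_mul_scaleIntegral {c : ℝ} (hc : 0 < c) (n : ℕ) {x : ℕ → ℝ}
    (hV : 0 < partialSumSq n x) :
    ENNReal.ofReal (gValue c n x) * scaleIntegral n (partialSumSq n x) =
      ENNReal.ofReal √(c ^ 2 / (n + c ^ 2)) *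
        scaleIntegral n (partialSumSq n x - partialSum n x ^ 2 / (n + c ^ 2)) := by
  obtain ⟨hg, hD⟩ := gValue_eq hc n hV
  have h1 : ENNReal.ofReal (partialSumSq n x ^ ((n : ℝ) / 2)) *
      ENNReal.ofReal (partialSumSq n x ^ (-((n : ℝ) / 2))) = 1 := by
    rw [← ENNReal.ofReal_mul (by positivity), ← Real.rpow_add hV, add_neg_cancel, Real.rpow_zero,
      ENNReal.ofReal_one]
  rw [hg, scaleIntegral_eq n hV, scaleIntegral_eq n hD, ENNReal.ofReal_mul (Real.sqrt_nonneg _),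
    ENNReal.ofReal_mul (by positivity)]
  generalize ENNReal.ofReal (partialSumSq n x ^ ((n : ℝ) / 2)) = a at *
  generalize ENNReal.ofReal (partialSumSq n x ^ (-((n : ℝ) / 2))) = b at *
  rw [mul_assoc, mul_mul_mul_comm, h1, one_mul]

lemma scaleMixtureLikelihood_eq (n : ℕ) (θ : ℝ) (x : ℕ → ℝ) :
    scaleMixtureLikelihood n θ x = ∫⁻ τ in Set.Ioi (0 : ℝ),
      ENNReal.ofReal (gaussKernel n τ (partialSumSq n x - 2 * (τ * θ) * partialSum n x +
        n * (τ * θ) ^ 2)) * ENNReal.ofReal τ⁻¹ := by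
  refine setLIntegral_congr_fun measurableSet_Ioi fun τ hτ => ?_
  simp only [prod_gaussianPDF _ _ (show (0 : ℝ) < τ from hτ), sum_sub_sq, Finset.card_range]
  rfl

/-- By Tonelli the prior can be integrated first, at each fixed scale. As the prior is on the
standardized mean `θ`, the factor it produces is free of `τ`. -/
lemma lintegral_scaleMixtureLikelihood {c : ℝ} (hc : 0 < c) (n : ℕ) (x : ℕ → ℝ) :
    ∫⁻ θ, scaleMixtureLikelihood n θ x ∂(gaussianReal 0 (1 / c ^ 2).toNNReal) =
      ENNReal.ofReal √(c ^ 2 / (n + c ^ 2)) *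
        scaleIntegral n (partialSumSq n x - partialSum n x ^ 2 / (n + c ^ 2)) := by
  simp only [scaleMixtureLikelihood_eq]
  rw [lintegral_lintegral_swap, scaleIntegral, ← lintegral_const_mul' _ _ (by simp)]
  · refine setLIntegral_congr_fun measurableSet_Ioi fun τ hτ => ?_
    rw [lintegral_mul_const' _ _ (by simp), lintegral_gaussKernel_prior n hc hτ, ← mul_assoc,
      ENNReal.ofReal_mul (Real.sqrt_nonneg _)]
  · refine Measurable.aemeasurable ?_
    refine Measurable.mul ?_ (ENNReal.measurable_ofReal.comp measurable_snd.inv)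
    exact ((measurable_gaussKernel n).comp (by fun_prop : Measurable fun p : ℝ × ℝ =>
      (p.2, partialSumSq n x - 2 * (p.2 * p.1) * partialSum n x +
        n * (p.2 * p.1) ^ 2))).ennreal_ofReal

lemma gValue_eq_lintegral_scaleInvLR {c : ℝ} (hc : 0 < c) {n : ℕ} (hn : 0 < n) {x : ℕ → ℝ}
    (hV : 0 < partialSumSq n x) :
    ENNReal.ofReal (gValue c n x) =
      ∫⁻ θ, scaleInvLR n θ 0 x ∂(gaussianReal 0 (1 / c ^ 2).toNNReal) := by
  have h0 : scaleMixtureLikelihood n 0 x = scaleIntegral n (partialSumSq n x) := by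
    simp [scaleMixtureLikelihood_eq, scaleIntegral]
  have hz : scaleIntegral n (partialSumSq n x) ≠ 0 := by
    rw [scaleIntegral_eq n hV]
    exact mul_ne_zero (by simpa using Real.rpow_pos_of_pos hV _) (scaleIntegral_one_ne_zero n)
  have ht : scaleIntegral n (partialSumSq n x) ≠ ∞ := by
    rw [scaleIntegral_eq n hV]
    exact ENNReal.mul_ne_top (by simp) (scaleIntegral_one_ne_top hn)
  simp only [scaleInvLR, h0, ENNReal.div_eq_inv_mul]
  rw [lintegral_const_mul' _ _ (ENNReal.inv_ne_top.2 hz), lintegral_scaleMixtureLikelihood hc,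
    ← gValue_mul_scaleIntegral hc n hV, ← ENNReal.div_eq_inv_mul, ENNReal.mul_div_cancel_right hz ht]

/-! ### Averaging over scales and the change of measure. -/

lemma lintegral_smul_comp {n : ℕ} (F : (Fin n → ℝ) → ℝ≥0∞) {a : ℝ} (ha : 0 < a) :
    ∫⁻ x, F x = ENNReal.ofReal (a ^ n) * ∫⁻ y, F (a • y) := by
  have h := Measure.map_addHaar_smul (volume : Measure (Fin n → ℝ)) (inv_ne_zero ha.ne')
  have h2 : ∫⁻ x, F x = ∫⁻ x, (fun y => F (a • y)) (a⁻¹ • x) := by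
    simp [smul_smul, ha.ne']
  rw [h2, ← (measurableEmbedding_const_smul₀ (inv_ne_zero ha.ne')).lintegral_map
    (fun y => F (a • y)), h, lintegral_smul_measure]
  simp [abs_of_pos ha]

/-- Averaging over all scales is a symmetric operation on pairs of functions, with respect to a
weight that is homogeneous of degree `n`. -/
lemma lintegral_scale_swap {n : ℕ} {u v w : (Fin n → ℝ) → ℝ≥0∞} (hu : Measurable u)
    (hv : Measurable v) (hw : Measurable w)
    (hom : ∀ (a : ℝ) x, 0 < a → w (a • x) = ENNReal.ofReal (a ^ n) * w x) :
    ∫⁻ x, w x * u x * ∫⁻ τ in Set.Ioi (0 : ℝ),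
        ENNReal.ofReal (τ ^ n)⁻¹ * v (τ⁻¹ • x) * ENNReal.ofReal τ⁻¹ =
      ∫⁻ x, w x * v x * ∫⁻ τ in Set.Ioi (0 : ℝ),
        ENNReal.ofReal (τ ^ n)⁻¹ * u (τ⁻¹ • x) * ENNReal.ofReal τ⁻¹ := by
  have meas : ∀ f : (Fin n → ℝ) → ℝ≥0∞, Measurable f → Measurable
      fun p : (Fin n → ℝ) × ℝ => ENNReal.ofReal (p.2 ^ n)⁻¹ * f (p.2⁻¹ • p.1) *
        ENNReal.ofReal p.2⁻¹ := fun f hf => by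
    have h1 : Measurable fun p : (Fin n → ℝ) × ℝ => f (p.2⁻¹ • p.1) :=
      hf.comp (by fun_prop)
    fun_prop
  have swap : ∀ f g : (Fin n → ℝ) → ℝ≥0∞, Measurable f → Measurable g →
      ∫⁻ x, w x * f x * ∫⁻ τ in Set.Ioi (0 : ℝ),
        ENNReal.ofReal (τ ^ n)⁻¹ * g (τ⁻¹ • x) * ENNReal.ofReal τ⁻¹ =
      ∫⁻ τ in Set.Ioi (0 : ℝ), (∫⁻ x, w x * f x * (ENNReal.ofReal (τ ^ n)⁻¹ * g (τ⁻¹ • x))) *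
        ENNReal.ofReal τ⁻¹ := fun f g hf hg => by
    have : ∀ x, w x * f x * ∫⁻ τ in Set.Ioi (0 : ℝ),
        ENNReal.ofReal (τ ^ n)⁻¹ * g (τ⁻¹ • x) * ENNReal.ofReal τ⁻¹ =
        ∫⁻ τ in Set.Ioi (0 : ℝ), w x * f x *
          (ENNReal.ofReal (τ ^ n)⁻¹ * g (τ⁻¹ • x) * ENNReal.ofReal τ⁻¹) := fun x => by
      exact (lintegral_const_mul _
        ((meas g hg).comp (by fun_prop : Measurable fun τ : ℝ => (x, τ)))).symm
    rw [lintegral_congr this, lintegral_lintegral_swap]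
    · refine lintegral_congr fun τ => ?_
      rw [← lintegral_mul_const' _ _ (by simp)]
      simp only [mul_assoc]
    · exact (((hw.comp measurable_fst).mul (hf.comp measurable_fst)).mul (meas g hg)).aemeasurable
  -- Replace `τ` by `τ⁻¹`, then `x` by `τ⁻¹ • x`. The Jacobian and the homogeneity of `w` each give
  -- `τ⁻¹ ^ n`: one cancels the existing factor, the other becomes the weight on the opposite side.
  rw [swap u v hu hv, swap v u hv hu, ← lintegral_Ioi_comp_inv]
  refine setLIntegral_congr_fun measurableSet_Ioi fun τ hτ => ?_
  have hτ' : (0 : ℝ) < τ := hτ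
  have hτi : (0 : ℝ) < τ⁻¹ := inv_pos.2 hτ'
  have hcancel : ENNReal.ofReal (τ⁻¹ ^ n) * ENNReal.ofReal (τ⁻¹ ^ n)⁻¹ = 1 := by
    rw [← ENNReal.ofReal_mul (by positivity), mul_inv_cancel₀ (by positivity), ENNReal.ofReal_one]
  rw [lintegral_smul_comp _ hτi, ← lintegral_const_mul' _ _ (by simp)]
  congr 1
  refine lintegral_congr fun x => ?_
  rw [hom _ _ hτi, inv_inv, smul_inv_smul₀ hτ'.ne']
  calc _ = (ENNReal.ofReal (τ⁻¹ ^ n) * ENNReal.ofReal (τ⁻¹ ^ n)⁻¹) *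
        (w x * v x * (ENNReal.ofReal (τ⁻¹ ^ n) * u (τ⁻¹ • x))) := by ring
    _ = _ := by rw [hcancel, one_mul, inv_pow]

lemma pi_gaussianReal_eq_withDensity (n : ℕ) (m : ℝ) {v : ℝ≥0} (hv : v ≠ 0) :
    Measure.pi (fun _ : Fin n => gaussianReal m v) =
      volume.withDensity fun x => ∏ i, gaussianPDF m v (x i) := by
  refine Measure.pi_eq fun s hs => ?_
  -- The integral over a box is rewritten as a Bochner integral of a product of one-variable
  -- functions, to which the product formula applies.
  have hf : ∀ i, Integrable ((s i).indicator (gaussianPDFReal m v)) := fun i =>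
    (integrable_gaussianPDFReal m v).indicator (hs i)
  have h0 : ∀ i y, 0 ≤ (s i).indicator (gaussianPDFReal m v) y := fun i y =>
    Set.indicator_nonneg (fun y _ => gaussianPDFReal_nonneg _ _ _) y
  have hmem : ∀ x : Fin n → ℝ, (Set.univ.pi s).indicator (fun x => ∏ i, gaussianPDF m v (x i)) x =
      ENNReal.ofReal (∏ i, (s i).indicator (gaussianPDFReal m v) (x i)) := fun x => by
    by_cases hx : x ∈ Set.univ.pi s
    · rw [Set.indicator_of_mem hx, ENNReal.ofReal_prod_of_nonneg fun i _ => h0 i _]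
      refine Finset.prod_congr rfl fun i _ => ?_
      rw [Set.indicator_of_mem (hx i trivial), gaussianPDF]
    · rw [Set.indicator_of_notMem hx]
      simp only [Set.mem_pi, Set.mem_univ, true_implies, not_forall] at hx
      obtain ⟨i, hi⟩ := hx
      rw [Finset.prod_eq_zero (Finset.mem_univ i) (Set.indicator_of_notMem hi _),
        ENNReal.ofReal_zero]
  rw [withDensity_apply _ (MeasurableSet.univ_pi hs), ← lintegral_indicator
    (MeasurableSet.univ_pi hs), lintegral_congr hmem, ← ofReal_integral_eq_lintegral_ofReal,
    integral_fintype_prod_volume_eq_prod, ENNReal.ofReal_prod_of_nonneg]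
  · refine Finset.prod_congr rfl fun i _ => ?_
    rw [integral_indicator (hs i), gaussianReal_apply_eq_integral _ hv]
  · exact fun i _ => integral_nonneg (h0 i)
  · exact Integrable.fintype_prod hf
  · exact Filter.Eventually.of_forall fun x => Finset.prod_nonneg fun i _ => h0 i _

lemma lintegral_pi_gaussianReal (n : ℕ) (m : ℝ) {τ : ℝ} (hτ : 0 < τ) {g : (Fin n → ℝ) → ℝ≥0∞}
    (hg : Measurable g) :
    ∫⁻ x, g x ∂Measure.pi (fun _ : Fin n => gaussianReal m (τ ^ 2).toNNReal) =
      ∫⁻ x, ENNReal.ofReal (gaussKernel n τ (∑ i, x i ^ 2 - 2 * m * ∑ i, x i + n * m ^ 2)) *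
        g x := by
  have hv : (τ ^ 2).toNNReal ≠ 0 := by
    simp only [ne_eq, Real.toNNReal_eq_zero, not_le]; positivity
  rw [pi_gaussianReal_eq_withDensity n m hv, lintegral_withDensity_eq_lintegral_mul _ _ hg]
  · refine lintegral_congr fun x => ?_
    simp only [Pi.mul_apply, prod_gaussianPDF _ _ hτ, sum_sub_sq, Finset.card_univ,
      Fintype.card_fin]
  · exact Finset.measurable_prod _ fun i _ =>
      (measurable_gaussianPDF _ _).comp (measurable_pi_apply i)

/-- The extension of a finite sequence by zeros. -/
def extendZero {n : ℕ} (x : Fin n → ℝ) : ℕ → ℝ := fun i => if h : i < n then x ⟨i, h⟩ else 0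

lemma extendZero_val {n : ℕ} (x : Fin n → ℝ) (i : Fin n) : extendZero x i = x i := by
  simp [extendZero]

lemma partialSum_extendZero {n : ℕ} (x : Fin n → ℝ) :
    partialSum n (extendZero x) = ∑ i, x i := by
  simp [partialSum, Finset.sum_range, extendZero_val]

lemma partialSumSq_extendZero {n : ℕ} (x : Fin n → ℝ) :
    partialSumSq n (extendZero x) = ∑ i, x i ^ 2 := by
  simp [partialSumSq, Finset.sum_range, extendZero_val]

lemma gValue_extendZero (c : ℝ) (n : ℕ) (x : ℕ → ℝ) :
    gValue c n (extendZero fun i : Fin n => x i) = gValue c n x := by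
  simp only [gValue, partialSum_extendZero, partialSumSq_extendZero]
  simp only [partialSum, partialSumSq, Finset.sum_range]

lemma measurable_gValue_extendZero (c : ℝ) (n : ℕ) :
    Measurable fun x : Fin n → ℝ => gValue c n (extendZero x) := by
  simp only [gValue, partialSum_extendZero, partialSumSq_extendZero]
  fun_prop

lemma gValue_extendZero_smul (c : ℝ) {n : ℕ} (x : Fin n → ℝ) {a : ℝ} (ha : 0 < a) :
    gValue c n (extendZero (a • x)) = gValue c n (extendZero x) := by
  simp only [gValue, partialSum_extendZero, partialSumSq_extendZero, Pi.smul_apply, smul_eq_mul,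
    mul_pow, ← Finset.mul_sum]
  have h : (n + c ^ 2) * (a ^ 2 * ∑ i, x i ^ 2) / ((n + c ^ 2) * (a ^ 2 * ∑ i, x i ^ 2) -
      a ^ 2 * (∑ i, x i) ^ 2) = a ^ 2 * ((n + c ^ 2) * ∑ i, x i ^ 2) /
      (a ^ 2 * ((n + c ^ 2) * ∑ i, x i ^ 2 - (∑ i, x i) ^ 2)) := by
    congr 1 <;> ring
  rw [h, mul_div_mul_left _ _ (by positivity)]

/-- Under the null hypothesis, `gValue` is the density of the normal mixture of alternatives with
respect to the scale invariant events. -/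
lemma lintegral_gValue_mul {c : ℝ} (hc : 0 < c) {n : ℕ} (hn : 0 < n) {σ : ℝ} (hσ : 0 < σ)
    {g : (Fin n → ℝ) → ℝ≥0∞} (hg : Measurable g) (hinv : ∀ (a : ℝ) x, 0 < a → g (a • x) = g x) :
    ∫⁻ x, ENNReal.ofReal (gValue c n (extendZero x)) * g x
        ∂Measure.pi (fun _ : Fin n => gaussianReal 0 (σ ^ 2).toNNReal) =
      ∫⁻ θ, ∫⁻ x, g x ∂Measure.pi (fun _ : Fin n => gaussianReal θ 1)
        ∂(gaussianReal 0 (1 / c ^ 2).toNNReal) := by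
  set V : (Fin n → ℝ) → ℝ := fun x => ∑ i, x i ^ 2
  set S : (Fin n → ℝ) → ℝ := fun x => ∑ i, x i
  have hVm : Measurable V := by fun_prop
  have hSm : Measurable S := by fun_prop
  have hVs : ∀ (a : ℝ) x, V (a • x) = a ^ 2 * V x := fun a x => by
    simp [V, mul_pow, Finset.mul_sum]
  have hSs : ∀ (a : ℝ) x, S (a • x) = a * S x := fun a x => by simp [S, Finset.mul_sum]
  have hV0 : ∀ x, 0 ≤ V x := fun x => Finset.sum_nonneg fun i _ => sq_nonneg _
  set D : (Fin n → ℝ) → ℝ := fun x => V x - S x ^ 2 / (n + c ^ 2)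
  have hDm : Measurable D := by fun_prop
  have hDs : ∀ (a : ℝ) x, D (a • x) = a ^ 2 * D x := fun a x => by
    simp only [D, hVs, hSs]; ring
  have hk : ∀ (τ : ℝ) {A : (Fin n → ℝ) → ℝ}, Measurable A →
      Measurable fun x => ENNReal.ofReal (gaussKernel n τ (A x)) := fun τ A hA =>
    ((measurable_gaussKernel n).comp (measurable_const.prodMk hA)).ennreal_ofReal
  -- The average over scales does not see the reference scale `ρ`. This is why `σ` disappears and
  -- the alternatives may have unit variance.
  have hscale : ∀ (ρ : ℝ) (A : (Fin n → ℝ) → ℝ), 0 < ρ → (∀ (a : ℝ) x, A (a • x) = a ^ 2 * A x) →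
      ∀ x, ∫⁻ τ in Set.Ioi (0 : ℝ), ENNReal.ofReal (τ ^ n)⁻¹ *
        ENNReal.ofReal (gaussKernel n ρ (A (τ⁻¹ • x))) * ENNReal.ofReal τ⁻¹ =
        scaleIntegral n (A x) := fun ρ A hρ hA x => by
    rw [scaleIntegral, 
      ← lintegral_Ioi_comp_mul (fun τ => ENNReal.ofReal (gaussKernel n τ (A x))) hρ]
    refine setLIntegral_congr_fun measurableSet_Ioi fun τ hτ => ?_
    have hτ' : (0 : ℝ) < τ := hτ
    rw [← ENNReal.ofReal_mul (by positivity), mul_comm ρ τ, gaussKernel_scale n hρ hτ', hA,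
      inv_pow, inv_mul_eq_div (τ ^ 2)]
  set k := ENNReal.ofReal √(c ^ 2 / (n + c ^ 2)) with hkdef
  set u : (Fin n → ℝ) → ℝ≥0∞ := fun x => ENNReal.ofReal (gaussKernel n σ (V x)) with hu
  set m : (Fin n → ℝ) → ℝ≥0∞ := fun x => ENNReal.ofReal (gaussKernel n 1 (D x)) with hm
  -- The factor `V ^ (n / 2)` gives `w` degree `n`, as the swap requires, and cancels the power of
  -- `V` in the averaged null density.
  set w : (Fin n → ℝ) → ℝ≥0∞ := fun x => g x * ENNReal.ofReal (V x ^ ((n : ℝ) / 2)) with hw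
  have hum : Measurable u := hk σ hVm
  have hmm : Measurable m := hk 1 hDm
  have hwm : Measurable w := hg.mul (hVm.pow_const _).ennreal_ofReal
  have hws : ∀ (a : ℝ) x, 0 < a → w (a • x) = ENNReal.ofReal (a ^ n) * w x := fun a x ha => by
    simp only [w]
    rw [hinv a x ha, hVs, Real.mul_rpow (sq_nonneg a) (hV0 x), ENNReal.ofReal_mul (by positivity),
      ← Real.rpow_natCast a 2, ← Real.rpow_mul ha.le, mul_left_comm, Nat.cast_ofNat,
      mul_div_cancel₀ _ (two_ne_zero' ℝ), Real.rpow_natCast]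
  have hJ0 := scaleIntegral_one_ne_zero n
  have hJt := scaleIntegral_one_ne_top hn
  have hswap := lintegral_scale_swap hum hmm hwm hws
  simp only [hu, hm, hscale σ V hσ hVs, hscale 1 D one_pos hDs] at hswap
  have hae : ∀ᵐ x : Fin n → ℝ, 0 < V x := by
    have : Nonempty (Fin n) := ⟨⟨0, hn⟩⟩
    filter_upwards [Measure.ae_ne volume (0 : Fin n → ℝ)] with x hx
    refine lt_of_le_of_ne (hV0 x) fun h => hx ?_
    ext i
    have := (Finset.sum_eq_zero_iff_of_nonneg fun i _ => sq_nonneg (x i)).1 h.symm i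
      (Finset.mem_univ i)
    simpa using this
  have hL : ∫⁻ x, ENNReal.ofReal (gValue c n (extendZero x)) * g x
        ∂Measure.pi (fun _ : Fin n => gaussianReal 0 (σ ^ 2).toNNReal) =
      ∫⁻ x, u x * (ENNReal.ofReal (gValue c n (extendZero x)) * g x) := by
    have := lintegral_pi_gaussianReal n 0 hσ
      ((measurable_gValue_extendZero c n).ennreal_ofReal.mul hg)
    simpa [hu, V] using this
  have hR : ∫⁻ θ, ∫⁻ x, g x ∂Measure.pi (fun _ : Fin n => gaussianReal θ 1)
        ∂(gaussianReal 0 (1 / c ^ 2).toNNReal) = ∫⁻ x, k * (m x * g x) := by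
    have h1 : ∀ θ, ∫⁻ x, g x ∂Measure.pi (fun _ : Fin n => gaussianReal θ 1) =
        ∫⁻ x, ENNReal.ofReal (gaussKernel n 1 (V x - 2 * (1 * θ) * S x + n * (1 * θ) ^ 2)) *
          g x := fun θ => by
      have := lintegral_pi_gaussianReal n θ one_pos hg
      simpa using this
    rw [lintegral_congr h1, lintegral_lintegral_swap]
    · refine lintegral_congr fun x => ?_
      rw [lintegral_mul_const _ ?_, lintegral_gaussKernel_prior n hc one_pos,
        ENNReal.ofReal_mul (Real.sqrt_nonneg _), mul_assoc]
      exact ((measurable_gaussKernel n).comp (by fun_prop : Measurable fun θ : ℝ =>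
        ((1 : ℝ), V x - 2 * (1 * θ) * S x + n * (1 * θ) ^ 2))).ennreal_ofReal
    · refine (Measurable.mul ?_ (hg.comp measurable_snd)).aemeasurable
      exact ((measurable_gaussKernel n).comp (by fun_prop : Measurable fun p : ℝ × (Fin n → ℝ) =>
        ((1 : ℝ), V p.2 - 2 * (1 * p.1) * S p.2 + n * (1 * p.1) ^ 2))).ennreal_ofReal
  have hV1 : ∀ x, 0 < V x → ENNReal.ofReal (V x ^ ((n : ℝ) / 2)) * scaleIntegral n (V x) =
      scaleIntegral n 1 := fun x hx => by
    rw [scaleIntegral_eq n hx, ← mul_assoc, ← ENNReal.ofReal_mul (by positivity),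
      ← Real.rpow_add hx, add_neg_cancel, Real.rpow_zero, ENNReal.ofReal_one, one_mul]
  -- Both sides are multiplied by the finite nonzero constant `scaleIntegral n 1`, which `hV1`
  -- trades for `V ^ (n / 2) * scaleIntegral n V` almost everywhere.
  rw [hL, hR, ← ENNReal.mul_right_inj hJ0 hJt, ← lintegral_const_mul' _ _ hJt,
    ← lintegral_const_mul' _ _ hJt]
  calc ∫⁻ x, scaleIntegral n 1 * (u x * (ENNReal.ofReal (gValue c n (extendZero x)) * g x))
      = ∫⁻ x, k * (w x * u x * scaleIntegral n (D x)) := by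
        refine lintegral_congr_ae (hae.mono fun x hx => ?_)
        have hG := gValue_mul_scaleIntegral hc n (x := extendZero x)
          (by rwa [partialSumSq_extendZero])
        rw [partialSumSq_extendZero, partialSum_extendZero] at hG
        change _ = k * scaleIntegral n (D x) at hG
        beta_reduce
        rw [← hV1 x hx]
        calc _ = w x * u x * (ENNReal.ofReal (gValue c n (extendZero x)) *
              scaleIntegral n (V x)) := by simp only [hw]; ring
          _ = _ := by rw [hG]; ring
    _ = ∫⁻ x, k * (w x * m x * scaleIntegral n (V x)) := by
        rw [lintegral_const_mul' _ _ (by simp [hkdef]), hswap,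
          lintegral_const_mul' _ _ (by simp [hkdef])]
    _ = ∫⁻ x, scaleIntegral n 1 * (k * (m x * g x)) := by
        refine lintegral_congr_ae (hae.mono fun x hx => ?_)
        beta_reduce
        rw [← hV1 x hx]
        simp only [hw]
        ring

/-! ### Events of the scale invariant σ-algebra. -/

section Sigma

variable {Ω : Type*}

/-- The measurable sets stable under positive dilations form a σ-algebra `𝒮` for which every scale
invariant function is measurable, so the generated σ-algebra lies in the pullback of `𝒮`. -/
lemma exists_scaleInvariant_preimage (X : ℕ → Ω → ℝ) (n : ℕ) {A : Set Ω}
    (hA : MeasurableSet[scaleInvSigma X n] A) :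
    ∃ B : Set (Fin n → ℝ), MeasurableSet B ∧ (∀ (a : ℝ) x, 0 < a → (a • x ∈ B ↔ x ∈ B)) ∧
      (fun ω (i : Fin n) => X i ω) ⁻¹' B = A := by
  let 𝒮 : MeasurableSpace (Fin n → ℝ) :=
    { MeasurableSet' := fun B => MeasurableSet B ∧ ∀ (a : ℝ) x, 0 < a → (a • x ∈ B ↔ x ∈ B)
      measurableSet_empty := ⟨MeasurableSet.empty, fun _ _ _ => Iff.rfl⟩
      measurableSet_compl := fun B hB => ⟨hB.1.compl, fun a x ha => not_congr (hB.2 a x ha)⟩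
      measurableSet_iUnion := fun B hB => ⟨MeasurableSet.iUnion fun i => (hB i).1,
        fun a x ha => by
          simp only [Set.mem_iUnion]
          exact exists_congr fun i => (hB i).2 a x ha⟩ }
  have hle : scaleInvSigma X n ≤ MeasurableSpace.comap (fun ω (i : Fin n) => X i ω) 𝒮 := by
    refine iSup₂_le fun f hf => ?_
    rintro _ ⟨T, hT, rfl⟩
    refine ⟨f ⁻¹' T, ⟨hf.1 hT, fun a x ha => ?_⟩, rfl⟩
    rw [Set.mem_preimage, Set.mem_preimage, show f (a • x) = f x from hf.2 x a ha]
  obtain ⟨B, hB, hBA⟩ := hle A hA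
  exact ⟨B, hB.1, hB.2, hBA⟩

lemma measurable_gValue_scaleInvSigma (X : ℕ → Ω → ℝ) (c : ℝ) (n : ℕ) :
    Measurable[scaleInvSigma X n] fun ω => gValue c n fun i => X i ω := by
  have hf : IsScaleInvariant fun x : Fin n → ℝ => gValue c n (extendZero x) :=
    ⟨measurable_gValue_extendZero c n, fun x a ha => gValue_extendZero_smul c x ha⟩
  refine Measurable.mono (measurable_iff_comap_le.2 le_rfl) ?_ le_rfl
  refine le_iSup₂_of_le (f := fun (f : (Fin n → ℝ) → ℝ) (_ : IsScaleInvariant f) =>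
    MeasurableSpace.comap (fun ω => f (fun i : Fin n => X i ω)) inferInstance) _ hf (le_of_eq ?_)
  congr 1
  ext ω
  exact (gValue_extendZero c n fun i => X i ω).symm

end Sigma

/-! ### The martingale property. -/

section Martingale

variable {Ω : Type*} [mΩ : MeasurableSpace Ω] {X : ℕ → Ω → ℝ} {Pr : Measure Ω}
  [IsProbabilityMeasure Pr]

lemma IsIIDSample.map_eq_pi {P : Measure ℝ} (h : IsIIDSample X P Pr) (n : ℕ) :
    Pr.map (fun ω (i : Fin n) => X i ω) = Measure.pi fun _ => P := by
  have hind : iIndepFun (fun i : Fin n => X i) Pr := h.2.1.precomp Fin.val_injective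
  rw [(iIndepFun_iff_map_fun_eq_pi_map fun i : Fin n => (h.1 i).aemeasurable).1 hind]
  congr 1
  ext1 i
  exact h.2.2 i

/-- Realizes the alternatives on one sequence space, so that events observed at different times are
measured by the same law. -/
lemma isIIDSample_infinitePi (P : Measure ℝ) [IsProbabilityMeasure P] :
    IsIIDSample (fun i (x : ℕ → ℝ) => x i) P (Measure.infinitePi fun _ => P) :=
  ⟨fun i => measurable_pi_apply i,
    iIndepFun_infinitePi (P := fun _ : ℕ => P) (X := fun _ y => y) fun _ => measurable_id,
    fun i => Measure.infinitePi_map_eval (μ := fun _ : ℕ => P) i⟩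

/-- The mass that `gValue` puts on a scale invariant event does not depend on the time: it is the
probability of this event under the normal mixture of alternatives. -/
lemma setLIntegral_gValue {c : ℝ} (hc : 0 < c) {n : ℕ} (hn : 0 < n) {v : ℝ≥0} (hv : v ≠ 0)
    (h : IsIIDSample X (gaussianReal 0 v) Pr) {B : Set (Fin n → ℝ)} (hB : MeasurableSet B)
    (hinv : ∀ (a : ℝ) x, 0 < a → (a • x ∈ B ↔ x ∈ B)) :
    ∫⁻ ω in (fun ω (i : Fin n) => X i ω) ⁻¹' B, ENNReal.ofReal (gValue c n fun i => X i ω) ∂Pr =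
      ∫⁻ θ, Measure.infinitePi (fun _ : ℕ => gaussianReal θ 1)
        ((fun x (i : Fin n) => x i) ⁻¹' B) ∂(gaussianReal 0 (1 / c ^ 2).toNNReal) := by
  have hσ : 0 < √(v : ℝ) := Real.sqrt_pos.2 (by positivity)
  have hσv : (√(v : ℝ) ^ 2).toNNReal = v := by
    rw [Real.sq_sqrt v.coe_nonneg, Real.toNNReal_coe]
  have hXm : Measurable fun ω (i : Fin n) => X i ω := measurable_pi_lambda _ fun i => h.1 i
  have hmain := lintegral_gValue_mul hc hn hσ (g := B.indicator 1) (measurable_one.indicator hB)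
    fun a x ha => by by_cases hx : x ∈ B <;> simp [hx, hinv a x ha]
  rw [hσv, ← h.map_eq_pi n, lintegral_map
    (by exact (measurable_gValue_extendZero c n).ennreal_ofReal.mul (measurable_one.indicator hB))
    hXm] at hmain
  rw [← lintegral_indicator (hXm hB)]
  calc _ = _ := lintegral_congr fun ω => ?_
    _ = _ := hmain
    _ = _ := lintegral_congr fun θ => ?_
  · rw [gValue_extendZero c n fun i => X i ω]
    by_cases hω : ω ∈ (fun ω (i : Fin n) => X i ω) ⁻¹' B
    · rw [Set.indicator_of_mem hω, Set.indicator_of_mem (Set.mem_preimage.1 hω), Pi.one_apply,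
        mul_one]
    · rw [Set.indicator_of_notMem hω, Set.indicator_of_notMem (Set.mem_preimage.not.1 hω),
        mul_zero]
  · rw [lintegral_indicator_one hB, ← (isIIDSample_infinitePi (gaussianReal θ 1)).map_eq_pi n,
      Measure.map_apply (measurable_pi_lambda _ fun i => measurable_pi_apply _) hB]

lemma measurable_gValue (hX : ∀ i, Measurable (X i)) (c : ℝ) (n : ℕ) :
    Measurable fun ω => gValue c n fun i => X i ω :=
  (measurable_gValue_scaleInvSigma X c n).mono (scaleInvSigma_le X hX n) le_rfl

lemma lintegral_gValue {c : ℝ} (hc : 0 < c) {n : ℕ} (hn : 0 < n) {v : ℝ≥0} (hv : v ≠ 0)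
    (h : IsIIDSample X (gaussianReal 0 v) Pr) :
    ∫⁻ ω, ENNReal.ofReal (gValue c n fun i => X i ω) ∂Pr = 1 := by
  simpa using setLIntegral_gValue hc hn hv h MeasurableSet.univ fun _ _ _ => by simp

lemma integrable_gValue {c : ℝ} (hc : 0 < c) {n : ℕ} (hn : 0 < n) {v : ℝ≥0} (hv : v ≠ 0)
    (h : IsIIDSample X (gaussianReal 0 v) Pr) :
    Integrable (fun ω => gValue c n fun i => X i ω) Pr := by
  refine (lintegral_ofReal_ne_top_iff_integrable
    (measurable_gValue h.1 c n).aestronglyMeasurable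
    (Filter.Eventually.of_forall fun ω => gValue_nonneg n _)).1 ?_
  rw [lintegral_gValue hc hn hv h]
  exact ENNReal.one_ne_top

lemma integral_gValue {c : ℝ} (hc : 0 < c) {n : ℕ} (hn : 0 < n) {v : ℝ≥0} (hv : v ≠ 0)
    (h : IsIIDSample X (gaussianReal 0 v) Pr) :
    ∫ ω, gValue c n (fun i => X i ω) ∂Pr = 1 := by
  rw [integral_eq_lintegral_of_nonneg_ae (Filter.Eventually.of_forall fun ω => gValue_nonneg n _)
    (measurable_gValue h.1 c n).aestronglyMeasurable, lintegral_gValue hc hn hv h,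
    ENNReal.toReal_one]

lemma martingale_gValue {c : ℝ} (hc : 0 < c) {v : ℝ≥0} (hv : v ≠ 0)
    (h : IsIIDSample X (gaussianReal 0 v) Pr) (hX : ∀ i, Measurable (X i)) :
    Martingale (fun (n : ℕ+) ω => gValue c n fun i => X i ω) (scaleInvFiltration X hX) Pr := by
  refine ⟨fun n => (measurable_gValue_scaleInvSigma X c n).stronglyMeasurable, fun i j hij => ?_⟩
  refine (ae_eq_condExp_of_forall_setIntegral_eq ((scaleInvFiltration X hX).le i)
    (integrable_gValue hc j.pos hv h) (fun A _ _ => (integrable_gValue hc i.pos hv h).integrableOn)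
    (fun A hA _ => ?_)
    (measurable_gValue_scaleInvSigma X c i).stronglyMeasurable.aestronglyMeasurable).symm
  obtain ⟨B, hB, hinv, rfl⟩ := exists_scaleInvariant_preimage X i hA
  have hij' : (i : ℕ) ≤ j := hij
  -- An event known at time `i` is viewed at time `j` by forgetting the later coordinates; it stays
  -- scale invariant. Its preimage in sequence space is unchanged, so `hi` and `hj` have the same
  -- right-hand side.
  have hBj : MeasurableSet ((fun (x : Fin (j : ℕ) → ℝ) k => x (Fin.castLE hij' k)) ⁻¹' B) :=
    (measurable_pi_lambda _ fun k => measurable_pi_apply _) hB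
  have hi := setLIntegral_gValue hc i.pos hv h hB hinv
  have hj := setLIntegral_gValue hc j.pos hv h hBj
    fun a x ha => hinv a (fun k => x (Fin.castLE hij' k)) ha
  rw [integral_eq_lintegral_of_nonneg_ae (Filter.Eventually.of_forall fun ω => gValue_nonneg _ _)
    (measurable_gValue hX c _).aestronglyMeasurable, integral_eq_lintegral_of_nonneg_ae
    (Filter.Eventually.of_forall fun ω => gValue_nonneg _ _)
    (measurable_gValue hX c _).aestronglyMeasurable]
  exact congrArg ENNReal.toReal (hi.trans hj.symm)

end Martingale

/-- With one observation the squared sum equals the sum of squares, so the data cancel off the null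
event that the observation is zero. -/
lemma gValue_one_ae_eq_one {Ω : Type*} [mΩ : MeasurableSpace Ω] {X : ℕ → Ω → ℝ} {Pr : Measure Ω}
    {c : ℝ} (hc : 0 < c) {v : ℝ≥0} (hv : v ≠ 0) (h : IsIIDSample X (gaussianReal 0 v) Pr) :
    ∀ᵐ ω ∂Pr, gValue c 1 (fun i => X i ω) = 1 := by
  have := nullSingletonClass_gaussianReal (μ := 0) hv
  have hne : ∀ᵐ y ∂Pr.map (X 0), y ≠ 0 := by
    rw [h.2.2 0]
    exact Measure.ae_ne _ _
  filter_upwards [ae_of_ae_map (h.1 0).aemeasurable hne] with ω hω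
  simp only [gValue, partialSum, partialSumSq, Finset.sum_range_one, Nat.cast_one]
  have h1 : (1 + c ^ 2) * X 0 ω ^ 2 / ((1 + c ^ 2) * X 0 ω ^ 2 - X 0 ω ^ 2) =
      (c ^ 2 / (1 + c ^ 2))⁻¹ := by
    rw [show (1 + c ^ 2) * X 0 ω ^ 2 - X 0 ω ^ 2 = c ^ 2 * X 0 ω ^ 2 by ring]
    field_simp
  rw [h1, ← Real.sqrt_eq_rpow, Real.sqrt_inv, mul_inv_cancel₀]
  positivity

/-! ### Ville's inequality and the confidence sequence. -/

/-- Ville's inequality for nonnegative martingales with initial expectation one. -/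
lemma ville_inequality {Ω : Type*} [mΩ : MeasurableSpace Ω] {Pr : Measure Ω} [IsFiniteMeasure Pr]
    {ℱ : Filtration ℕ+ mΩ} {M : ℕ+ → Ω → ℝ} (hM : Martingale M ℱ Pr) (h0 : ∀ n ω, 0 ≤ M n ω)
    (h1 : ∫ ω, M 1 ω ∂Pr = 1) {α : ℝ} (hα : 0 < α) :
    Pr {ω | ∃ n, α⁻¹ ≤ M n ω} ≤ ENNReal.ofReal α := by
  let 𝒢 : Filtration ℕ mΩ := ⟨fun k => ℱ k.succPNat,
    fun i j hij => ℱ.mono (Nat.succPNat_le_succPNat.2 hij), fun k => ℱ.le _⟩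
  have hG : Martingale (fun k => M k.succPNat) 𝒢 Pr :=
    ⟨fun k => hM.1 _, fun i j hij => hM.2 _ _ (Nat.succPNat_le_succPNat.2 hij)⟩
  let ε : ℝ≥0 := ⟨α⁻¹, (inv_pos.2 hα).le⟩
  -- Doob's maximal inequality bounds each finite-horizon event; these increase to the event of ever
  -- crossing, and continuity from below passes to the limit.
  let E : ℕ → Set Ω := fun N => {ω | (ε : ℝ) ≤ (Finset.range (N + 1)).sup'
    Finset.nonempty_range_add_one fun k => M k.succPNat ω}
  have hE : ∀ N, Pr (E N) ≤ ENNReal.ofReal α := fun N => by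
    have hmax := maximal_ineq hG.submartingale (fun k ω => h0 _ ω) (ε := ε) N
    have hint : ∫ ω in E N, M N.succPNat ω ∂Pr ≤ 1 := by
      refine (setIntegral_le_integral (hG.integrable N)
        (Filter.Eventually.of_forall fun ω => h0 _ ω)).trans (le_of_eq ?_)
      have := hG.setIntegral_eq (Nat.zero_le N) MeasurableSet.univ
      rw [setIntegral_univ, setIntegral_univ] at this
      rw [← this]
      exact h1
    have hle : (ε : ℝ≥0∞) * Pr (E N) ≤ 1 :=
      hmax.trans ((ENNReal.ofReal_le_ofReal hint).trans_eq ENNReal.ofReal_one)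
    have hε : (ε : ℝ≥0∞) = (ENNReal.ofReal α)⁻¹ := by
      rw [← ENNReal.ofReal_inv_of_pos hα, ENNReal.ofReal_eq_coe_nnreal (inv_pos.2 hα).le]
      rfl
    rw [hε, ← ENNReal.div_eq_inv_mul] at hle
    have := (ENNReal.div_le_iff (by simpa using hα) (by simp)).1 hle
    rwa [one_mul] at this
  have hmem : ∀ N ω, ω ∈ E N ↔ ∃ k ∈ Finset.range (N + 1), α⁻¹ ≤ M k.succPNat ω := fun N ω => by
    simp only [E, Set.mem_ofPred_eq, Finset.le_sup'_iff]
    rfl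
  have hmono : Monotone E := fun N N' hN ω hω => by
    obtain ⟨k, hk, hle⟩ := (hmem N ω).1 hω
    exact (hmem N' ω).2
      ⟨k, Finset.mem_range.2 ((Finset.mem_range.1 hk).trans_le (by omega)), hle⟩
  have hsub : {ω | ∃ n, α⁻¹ ≤ M n ω} ⊆ ⋃ N, E N := by
    rintro ω ⟨n, hn⟩
    refine Set.mem_iUnion.2 ⟨n.natPred, (hmem _ ω).2
      ⟨n.natPred, Finset.self_mem_range_succ _, ?_⟩⟩
    rw [PNat.succPNat_natPred]
    exact hn
  refine (measure_mono hsub).trans ?_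
  rw [hmono.measure_iUnion]
  exact iSup_le hE

/-- Squaring the bound and taking an `n`-th root gives an inequality linear in the squared distance
from `m` to the sample mean. The coefficient of that square is `radiusDenom`: if positive, one
divides by it; otherwise the interval is the whole line. -/
lemma mem_interval_of_gValue_lt {c α : ℝ} (hc : 0 < c) (hα : 0 < α) {n : ℕ}
    (hn : 0 < n) (x : ℕ → ℝ) (m : ℝ) (h : gValue c n (fun i => x i - m) < α⁻¹) :
    m ∈ interval c α n x := by
  unfold interval radius
  rw [Set.mem_ofPred_eq]
  split_ifs with hden
  · simp
  have hrd : 0 < radiusDenom c α n := by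
    by_contra hle
    exact hden (max_eq_right (not_lt.1 hle))
  rw [max_eq_left hrd.le]
  have hn' : (0 : ℝ) < n := by exact_mod_cast hn
  have hnc : 0 < (n : ℝ) + c ^ 2 := by positivity
  set β := α ^ 2 * c ^ 2 / (n + c ^ 2) with hβ
  have hβ0 : 0 < β := by positivity
  set b := β ^ (1 / (n : ℝ)) with hb
  have hb0 : 0 < b := Real.rpow_pos_of_pos hβ0 _
  have hbn : b ^ n = β := by
    rw [hb, ← Real.rpow_natCast, ← Real.rpow_mul hβ0.le, one_div_mul_cancel hn'.ne', Real.rpow_one]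
  have hrd_eq : radiusDenom c α n = b * (n + c ^ 2) - c ^ 2 := rfl
  set T := partialSum n fun i => x i - m with hT
  set W := partialSumSq n fun i => x i - m with hW
  have hTW : T ^ 2 ≤ n * W := partialSum_sq_le n _
  have hW0 : 0 ≤ W := partialSumSq_nonneg n _
  have hkey : T ^ 2 ≤ (1 - b) * ((n + c ^ 2) * W) := by
    -- If all centred observations vanish, the ratio is the default `0 / 0` and `h` says nothing;
    -- Cauchy–Schwarz alone gives the claim.
    rcases hW0.eq_or_lt with hWz | hWpos
    · rw [← hWz] at hTW ⊢
      simpa using hTW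
    have hD : 0 < (n + c ^ 2) * W - T ^ 2 := by nlinarith [mul_pos (pow_pos hc 2) hWpos]
    set R := (n + c ^ 2) * W / ((n + c ^ 2) * W - T ^ 2) with hR
    have hR0 : 0 < R := by positivity
    have hg : √(c ^ 2 / (n + c ^ 2)) * R ^ ((n : ℝ) / 2) < α⁻¹ := h
    have hsq := pow_lt_pow_left₀ hg (by positivity) two_ne_zero
    have hRn : (R ^ ((n : ℝ) / 2)) ^ 2 = R ^ n := by
      rw [← Real.rpow_natCast, ← Real.rpow_mul hR0.le, Nat.cast_ofNat,
        div_mul_cancel₀ _ (two_ne_zero' ℝ), Real.rpow_natCast]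
    rw [mul_pow, Real.sq_sqrt (by positivity), hRn] at hsq
    have hbR : (b * R) ^ n < 1 := by
      rw [mul_pow, hbn, hβ]
      calc α ^ 2 * c ^ 2 / (n + c ^ 2) * R ^ n = α ^ 2 * (c ^ 2 / (n + c ^ 2) * R ^ n) := by ring
        _ < α ^ 2 * α⁻¹ ^ 2 := mul_lt_mul_of_pos_left hsq (by positivity)
        _ = 1 := by field_simp
    have hbR1 : b * R < 1 := lt_of_pow_lt_pow_left₀ n zero_le_one (by simpa using hbR)
    rw [hR, ← mul_div_assoc, div_lt_one hD] at hbR1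
    linarith
  have hTe : T = n * (sampleMean n x - m) := by
    simp only [hT, partialSum, sampleMean, Finset.sum_sub_distrib, Finset.sum_const,
      Finset.card_range, nsmul_eq_mul]
    field_simp
  have hWe : W = n * (sampleMeanSq n x - sampleMean n x ^ 2 + (sampleMean n x - m) ^ 2) := by
    simp only [hW, partialSumSq, sampleMean, sampleMeanSq, sum_sub_sq, Finset.card_range,
      partialSum]
    field_simp
    ring
  set s := sampleMeanSq n x - sampleMean n x ^ 2 with hs
  have hd : (sampleMean n x - m) ^ 2 ≤ (n + c ^ 2) * (1 - b) / radiusDenom c α n * s := by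
    rw [div_mul_eq_mul_div, le_div_iff₀ hrd, hrd_eq]
    rw [hTe, hWe] at hkey
    refine le_of_mul_le_mul_left ?_ hn'
    linarith
  have habs := abs_le.1 (Real.abs_le_sqrt hd)
  rw [← EReal.coe_sub, ← EReal.coe_add, EReal.coe_le_coe_iff, EReal.coe_le_coe_iff]
  constructor <;> linarith

lemma isConfidenceSequence_interval {Ω : Type*} [mΩ : MeasurableSpace Ω] (X : ℕ → Ω → ℝ) {c : ℝ}
    (hc : 0 < c) {α : ℝ} (hα : 0 < α) :
    IsConfidenceSequence X normalClass mean α fun n ω => interval c α n fun i => X i ω := by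
  rintro _ ⟨m, v, hv, rfl⟩ Pr hPr h
  -- Centring at the true mean reduces to the null with the same variance.
  have hY : IsIIDSample (fun i ω => X i ω - m) (gaussianReal 0 v) Pr := by
    refine ⟨fun i => (h.1 i).sub_const m,
      h.2.1.comp (fun _ y => y - m) fun _ => measurable_id.sub_const m, fun i => ?_⟩
    have := Measure.map_map (μ := Pr) (measurable_id.sub_const m) (h.1 i)
    rw [h.2.2 i] at this
    refine this.symm.trans ?_
    simpa using gaussianReal_map_sub_const (μ := m) (v := v) m
  have hmean : mean (gaussianReal m v) = m := integral_id_gaussianReal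
  have hville := ville_inequality (martingale_gValue hc hv hY hY.1) (fun n ω => gValue_nonneg _ _)
    (integral_gValue hc one_pos hv hY) hα
  set E := {ω | ∃ n : ℕ+, α⁻¹ ≤ gValue c n fun i => X i ω - m} with hE
  have hEm : MeasurableSet E := by
    have : E = ⋃ n : ℕ+, {ω | α⁻¹ ≤ gValue c n fun i => X i ω - m} := by
      ext ω; simp [hE]
    rw [this]
    exact MeasurableSet.iUnion fun n =>
      measurableSet_le measurable_const (measurable_gValue hY.1 c n)
  calc ENNReal.ofReal (1 - α) = 1 - ENNReal.ofReal α := by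
        rw [ENNReal.ofReal_sub _ hα.le, ENNReal.ofReal_one]
    _ ≤ 1 - Pr E := tsub_le_tsub_left hville 1
    _ = Pr Eᶜ := (prob_compl_eq_one_sub hEm).symm
    _ ≤ _ := by
      refine measure_mono fun ω hω => Set.mem_ofPred_eq ▸ fun n => ?_
      rw [hmean]
      exact mem_interval_of_gValue_lt hc hα n.pos _ m
        (not_le.1 fun hle => hω ⟨n, hle⟩)

end TTest

end

theorem mainTheorem2 {Ω : Type*} [mΩ : MeasurableSpace Ω] (X : ℕ → Ω → ℝ)
    (hX : ∀ i, Measurable (X i)) (c : ℝ) (hc : 0 < c) :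
    -- `G` is a test martingale on the scale invariant filtration
    TTest.IsTestMartingale X (TTest.normalClassMean 0) (TTest.scaleInvFiltration X hX)
      (fun n ω => TTest.gValue c n (fun i => X i ω)) ∧
    -- its initial value is one and all its expected values are one
    (∀ P ∈ TTest.normalClassMean 0, ∀ Pr : Measure Ω, IsProbabilityMeasure Pr →
      TTest.IsIIDSample X P Pr →
      (∀ᵐ ω ∂Pr, TTest.gValue c 1 (fun i => X i ω) = 1) ∧
      ∀ n : ℕ+, ∫ ω, TTest.gValue c n (fun i => X i ω) ∂Pr = 1) ∧
    -- it is the mixture of scale invariant likelihood ratios over a centred normal prior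
    (∀ (n : ℕ+) (x : ℕ → ℝ), 0 < TTest.partialSumSq n x →
      ENNReal.ofReal (TTest.gValue c n x) =
        ∫⁻ θ, TTest.scaleInvLR n θ 0 x ∂(gaussianReal 0 (1 / c ^ 2).toNNReal)) ∧
    -- the confidence sequence for the mean over all normal distributions
    (∀ α : ℝ, 0 < α → α < 1 →
      TTest.IsConfidenceSequence X TTest.normalClass TTest.mean α
        (fun n ω => TTest.interval c α n (fun i => X i ω))) := by
  refine ⟨?_, ?_, fun n x hV => TTest.gValue_eq_lintegral_scaleInvLR hc n.pos hV,
    fun α hα _ => TTest.isConfidenceSequence_interval X hc hα⟩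
  · rintro _ ⟨v, hv, rfl⟩ Pr hPr h
    exact ⟨fun n ω => TTest.gValue_nonneg _ _, TTest.martingale_gValue hc hv h hX,
      TTest.integral_gValue hc one_pos hv h⟩
  · rintro _ ⟨v, hv, rfl⟩ Pr hPr h
    exact ⟨TTest.gValue_one_ae_eq_one hc hv h, fun n => TTest.integral_gValue hc n.pos hv h⟩
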